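/- Let $\boldsymbol{T}=\mathbb{R}\cup\{-\infty\}$ be the tropical semifield, with $a\oplus b=\max\{a,b\}$ and $a\odot b=a+b$. All semirings are commutative with $0$ and $1$, and a semifield is a semiring with $0\neq 1$ in which every nonzero element is invertible. A semifield over $\boldsymbol{T}$ is a semifield $S$ with an injective semiring homomorphism $\boldsymbol{T}\to S$; it is finitely generated if, for some finite subset of $S$, the smallest subsemifield containing this subset and the image of $\boldsymbol{T}$ is $S$. Two tropical polynomials in $Y_1,\dots,Y_m$ are identified if they define the same function on $\boldsymbol{T}^m$; the tropical rational function semifield $\overline{\boldsymbol{T}(Y_1,\dots,Y_m)}$ is the semifield of fractions of the resulting (cancellative) quotient semiring of $\boldsymbol{T}[Y_1,\dots,Y_m]$. Its elements have values in $\boldsymbol{T}$ at the points of $\mathbb{R}^m$. A congruence on a semiring $R$ is an equivalence relation $C\subset R^2$ compatible with addition and multiplication; it is finitely generated if it is the smallest congruence containing some finite set of pairs. For a semiring homomorphism $\varphi\colon R\to R'$ put $\operatorname{Ker}(\varphi)=\{(f,g)\in R^2 : \varphi(f)=\varphi(g)\}$. For a congruence $C$ on $\overline{\boldsymbol{T}(Y_1,\dots,Y_m)}$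 put $\boldsymbol{V}(C)=\{x\in\mathbb{R}^m : f(x)=g(x)\text{ for all }(f,g)\in C\}$, and for $V\subset\mathbb{R}^m$ put $\boldsymbol{E}(V)=\{(f,g)\in\overline{\boldsymbol{T}(Y_1,\dots,Y_m)}^2 : f(x)=g(x)\text{ for all }x\in V\}$. For a nonempty family $(T_i)_{i\in I}$ of semifields over $\boldsymbol{T}$, the pseudodirect product $\bowtie_{i\in I}T_i$ is the set of all families $(t_i)_{i\in I}\in\prod_{i\in I}T_i$ that either have all entries nonzero or have all entries zero, with the entrywise operations, regarded as a $\boldsymbol{T}$-algebra by the diagonal homomorphism $t\mapsto(t)_{i\in I}$. **Corollary.** Let $T$ be a finitely generated semifield over $\boldsymbol{T}$, let $m\ge 0$, and let $\varphi\colon\overline{\boldsymbol{T}(Y_1,\dots,Y_m)}\to T$ be a surjective $\boldsymbol{T}$-algebra homomorphism. Assume that $\operatorname{Ker}(\varphi)=\boldsymbol{E}(\boldsymbol{V}(\operatorname{Ker}(\varphi)))$ and that $\operatorname{Ker}(\varphi)$ is finitely generated as a congruence. Then there is no infinite family $(T_i)_{i\in I}$ of semifields over $\boldsymbol{T}$ (in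 particular no infinite sequence $T_1,T_2,\dots$) such that $T$ is isomorphic to $\bowtie_{i\in I}T_i$ as a $\boldsymbol{T}$-algebra. -/

import Mathlib

/-- The tropical semifield `𝕋 = ℝ ∪ {-∞}` with `a ⊕ b = max a b` and `a ⊙ b = a + b`. -/
def Trop : Type := WithBot ℝ

namespace Trop

/-- The underlying element of `ℝ ∪ {-∞}`. -/
def toWithBot (a : Trop) : WithBot ℝ := a

/-- A real number, as an element of the tropical semifield. -/
def ofReal (r : ℝ) : Trop := (r : WithBot ℝ)

/-- Tropical inversion: `r ↦ -r` on real numbers, and `-∞ ↦ -∞` by convention. -/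
def inv (a : Trop) : Trop := WithBot.map (fun r : ℝ => -r) (toWithBot a)

noncomputable instance instAdd : Add Trop :=
  ⟨fun a b => (max (toWithBot a) (toWithBot b) : WithBot ℝ)⟩

noncomputable instance instMul : Mul Trop :=
  ⟨fun a b => (toWithBot a + toWithBot b : WithBot ℝ)⟩

instance instZero : Zero Trop := ⟨(⊥ : WithBot ℝ)⟩

instance instOne : One Trop := ⟨ofReal 0⟩

noncomputable instance instCommSemiring : CommSemiring Trop where
  add_assoc a b c := max_assoc (toWithBot a) (toWithBot b) (toWithBot c)
  zero_add a := bot_sup_eq (toWithBot a)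
  add_zero a := sup_bot_eq (toWithBot a)
  add_comm a b := max_comm (toWithBot a) (toWithBot b)
  mul_assoc a b c := add_assoc (toWithBot a) (toWithBot b) (toWithBot c)
  one_mul a := zero_add (toWithBot a)
  mul_one a := add_zero (toWithBot a)
  mul_comm a b := add_comm (toWithBot a) (toWithBot b)
  zero_mul a := WithBot.bot_add (toWithBot a)
  mul_zero a := WithBot.add_bot (toWithBot a)
  nsmul := nsmulRec
  left_distrib a b c := (max_add_add_left (toWithBot a) (toWithBot b) (toWithBot c)).symm
  right_distrib a b c := (max_add_add_right (toWithBot a) (toWithBot b) (toWithBot c)).symm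

theorem toWithBot_add (a b : Trop) :
    toWithBot (a + b) = max (toWithBot a) (toWithBot b) := rfl

theorem toWithBot_mul (a b : Trop) : toWithBot (a * b) = toWithBot a + toWithBot b := rfl

theorem toWithBot_zero : toWithBot (0 : Trop) = ⊥ := rfl

theorem toWithBot_one : toWithBot (1 : Trop) = 0 := rfl

theorem ofReal_ne_zero (r : ℝ) : ofReal r ≠ 0 := WithBot.coe_ne_bot

theorem exists_ofReal_of_ne_zero {a : Trop} (h : a ≠ 0) : ∃ r, a = ofReal r := by
  obtain ⟨r, hr⟩ := WithBot.ne_bot_iff_exists.1 (show toWithBot a ≠ ⊥ from h)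
  exact ⟨r, hr.symm⟩

theorem ofReal_mul (r s : ℝ) : ofReal r * ofReal s = ofReal (r + s) := rfl

noncomputable instance instSemifield : Semifield Trop where
  inv := inv
  exists_pair_ne := ⟨0, 1, fun h => ofReal_ne_zero 0 h.symm⟩
  mul_inv_cancel a ha := by
    obtain ⟨r, rfl⟩ := exists_ofReal_of_ne_zero ha
    change ofReal r * ofReal (-r) = ofReal 0
    rw [ofReal_mul, add_neg_cancel]
  inv_zero := rfl
  nnqsmul := _
  nnqsmul_def := fun _ _ => rfl

theorem add_self (a : Trop) : a + a = a := max_self (toWithBot a)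

theorem eq_zero_of_add_eq_zero {a b : Trop} (h : a + b = 0) : a = 0 := by
  rw [← add_zero a, ← h, ← add_assoc, add_self]

theorem eq_zero_of_sum_eq_zero {ι : Type*} (s : Finset ι) (f : ι → Trop)
    (h : ∑ i ∈ s, f i = 0) : ∀ i ∈ s, f i = 0 := by
  intro i hi
  classical
  rw [← Finset.add_sum_erase s f hi] at h
  exact eq_zero_of_add_eq_zero h

end Trop

/-- The congruence on `𝕋[X₁, …, Xₙ]` identifying two tropical polynomials that
define the same function on `𝕋ⁿ`. -/
def tropFunCon (n : ℕ) : RingCon (MvPolynomial (Fin n) Trop) where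
  r f g := ∀ x : Fin n → Trop, MvPolynomial.eval x f = MvPolynomial.eval x g
  iseqv := ⟨fun _ _ => rfl, fun h x => (h x).symm, fun h k x => (h x).trans (k x)⟩
  add' h k x := by rw [map_add, map_add, h x, k x]
  mul' h k x := by rw [map_mul, map_mul, h x, k x]

/-- The tropical polynomial function semiring in `n` variables. -/
abbrev TropPolyFun (n : ℕ) : Type := (tropFunCon n).Quotient

namespace TropPolyFun

/-- Evaluation of a tropical polynomial function at a point of `𝕋ⁿ`. -/
noncomputable def eval {n : ℕ} (x : Fin n → Trop) : TropPolyFun n →+* Trop :=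
  (tropFunCon n).lift (MvPolynomial.eval x) (fun _ _ h => h x)

theorem eval_ofReal_ne_zero {n : ℕ} (x : Fin n → ℝ) {f : TropPolyFun n} (hf : f ≠ 0) :
    eval (fun i => Trop.ofReal (x i)) f ≠ 0 := by
  obtain ⟨p, rfl⟩ := (tropFunCon n).mk'_surjective f
  intro h
  apply hf
  suffices hp : p = 0 by rw [hp, map_zero]
  change MvPolynomial.eval (fun i => Trop.ofReal (x i)) p = 0 at h
  rw [MvPolynomial.eval_eq'] at h
  ext d
  rw [MvPolynomial.coeff_zero]
  by_contra hd
  have hz := Trop.eq_zero_of_sum_eq_zero _ _ h d (MvPolynomial.mem_support_iff.2 hd)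
  rcases mul_eq_zero.1 hz with h1 | h1
  · exact hd h1
  · obtain ⟨i, -, hi⟩ := Finset.prod_eq_zero_iff.1 h1
    exact Trop.ofReal_ne_zero _ (eq_zero_of_pow_eq_zero hi)

instance instNontrivial (n : ℕ) : Nontrivial (TropPolyFun n) :=
  ⟨⟨0, 1, fun h => zero_ne_one (α := Trop) (by
    simpa using congrArg (eval (fun _ => (0 : Trop))) h)⟩⟩

/-- The nonzero elements and the non-zero-divisors of the tropical polynomial function
semiring are the same, so that localizing at either gives its semifield of fractions. -/
theorem mem_nonZeroDivisors_iff {n : ℕ} (f : TropPolyFun n) :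
    f ∈ nonZeroDivisors (TropPolyFun n) ↔ f ≠ 0 := by
  refine ⟨fun h => nonZeroDivisors.ne_zero h, fun hf => ?_⟩
  have key : ∀ g : TropPolyFun n, g * f = 0 → g = 0 := by
    intro g hg
    by_contra hne
    have h := congrArg (eval (fun i : Fin n => Trop.ofReal ((fun _ => (0 : ℝ)) i))) hg
    rw [map_mul, map_zero] at h
    rcases mul_eq_zero.1 h with h1 | h1
    · exact eval_ofReal_ne_zero _ hne h1
    · exact eval_ofReal_ne_zero _ hf h1
  exact mem_nonZeroDivisors_iff_right.2 key

end TropPolyFun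

/-- The tropical rational function semifield in `n` variables: the semifield of fractions
of the tropical polynomial function semiring. -/
abbrev TropRat (n : ℕ) : Type := Localization (nonZeroDivisors (TropPolyFun n))

namespace TropRat

/-- The value `f(x)` of a tropical rational function `f` at a point `x` of `ℝⁿ`. -/
noncomputable def eval {n : ℕ} (x : Fin n → ℝ) : TropRat n →+* Trop :=
  IsLocalization.lift (M := nonZeroDivisors (TropPolyFun n)) (S := TropRat n)
    (g := TropPolyFun.eval (fun i => Trop.ofReal (x i)))
    (fun f => isUnit_iff_ne_zero.2
      (TropPolyFun.eval_ofReal_ne_zero x (nonZeroDivisors.ne_zero f.2)))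

/-- The congruence variety `V(E)` of a congruence `E`. -/
def variety {n : ℕ} (E : RingCon (TropRat n)) : Set (Fin n → ℝ) :=
  {x | ∀ f g : TropRat n, E f g → eval x f = eval x g}

/-- The congruence `E(V)` of all pairs of tropical rational functions that agree on `V`. -/
def vanishingCon {n : ℕ} (V : Set (Fin n → ℝ)) : RingCon (TropRat n) where
  r f g := ∀ x ∈ V, eval x f = eval x g
  iseqv := ⟨fun _ _ _ => rfl, fun h x hx => (h x hx).symm,
    fun h k x hx => (h x hx).trans (k x hx)⟩
  add' h k x hx := by rw [map_add, map_add, h x hx, k x hx]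
  mul' h k x hx := by rw [map_mul, map_mul, h x hx, k x hx]

end TropRat

/-- A congruence is finitely generated if it is the smallest congruence containing some
finite set of pairs. -/
def RingCon.IsFinitelyGenerated {R : Type*} [Semiring R] (E : RingCon R) : Prop :=
  ∃ s : Finset (R × R), ringConGen (fun a b => (a, b) ∈ s) = E

/-- A semifield `S` that is a `𝕋`-algebra is a semifield over `𝕋` if its structure
homomorphism is injective. -/
def IsSemifieldOverTrop (S : Type*) [Semifield S] [Algebra Trop S] : Prop :=
  Function.Injective (algebraMap Trop S)

/-- `S` is finitely generated as a semifield over `𝕋`: for some finite subset `s`, the only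
subsemifield of `S` containing `s` and the image of `𝕋` is `S` itself. -/
def IsFinitelyGeneratedSemifieldOverTrop (S : Type*) [Semifield S] [Algebra Trop S] : Prop :=
  ∃ s : Finset S, ∀ K : Subalgebra Trop S,
    (↑s : Set S) ⊆ K → (∀ a ∈ K, a⁻¹ ∈ K) → K = ⊤

theorem eq_zero_of_add_eq_zero_of_algebra_trop {S : Type*} [Semifield S] [Algebra Trop S]
    {a b : S} (h : a + b = 0) : a = 0 := by
  have h2 : a + a = a := by
    have h1 : (1 : S) + 1 = 1 := by
      rw [← map_one (algebraMap Trop S), ← map_add, Trop.add_self]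
    rw [← mul_one a, ← mul_add, h1]
  rw [← add_zero a, ← h, ← add_assoc, h2]

/-- The pseudodirect product of a family of semifields over `𝕋`: the families with all
entries nonzero, together with the zero family, with the entrywise operations and the
diagonal `𝕋`-algebra structure. -/
def pseudodirectProduct {ι : Type*} (S : ι → Type*) [∀ i, Semifield (S i)]
    [∀ i, Algebra Trop (S i)] : Subalgebra Trop (∀ i, S i) where
  carrier := {s | (∀ i, s i ≠ 0) ∨ s = 0}
  mul_mem' := by
    rintro a b (ha | rfl) (hb | rfl)
    · exact Or.inl fun i => mul_ne_zero (ha i) (hb i)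
    · exact Or.inr (mul_zero a)
    · exact Or.inr (zero_mul b)
    · exact Or.inr (zero_mul 0)
  add_mem' := by
    rintro a b (ha | rfl) hb
    · exact Or.inl fun i h => ha i (eq_zero_of_add_eq_zero_of_algebra_trop h)
    · simpa using hb
  algebraMap_mem' := by
    intro t
    by_cases ht : t = 0
    · exact Or.inr (by rw [ht, map_zero])
    · exact Or.inl fun i => ((isUnit_iff_ne_zero.2 ht).map (algebraMap Trop (S i))).ne_zero

/-! Let V be the variety of the kernel of φ. Each generating pair of the kernel equates two
piecewise affine functions (or involves 0), so finite generation makes V a finite union of convex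
sets. An infinite pseudodirect product would force V to have infinitely many pieces.

Indeed, let e_i be the family with real entry 1 at i and 0 (the tropical one) elsewhere. Algebraic
identities force e_i to take only the values 0 and 1 on V, and forbid two distinct e_i, e_j from
both being 1 at a point. Since the kernel is E(V), e_i is not constantly 0 on V, so it is 1 at some
x_i in V. By pigeonhole some x_i and x_j with i ≠ j lie in one convex piece. Along the segment
joining them e_i is continuous, equals 1 at x_i and 0 at x_j, yet avoids 1/2: a contradiction. -/

/-- A set is finitely convex if it is a union of finitely many convex sets. -/
def IsFinitelyConvex {E : Type*} [AddCommGroup E] [Module ℝ E] (V : Set E) : Prop :=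
  ∃ (κ : Type) (_ : Finite κ) (C : κ → Set E), (∀ k, Convex ℝ (C k)) ∧ V = ⋃ k, C k

/-- A continuous function that is affine on each member of some finite convex cover. -/
def IsPiecewiseAffine {E : Type*} [AddCommGroup E] [Module ℝ E] [TopologicalSpace E]
    (h : E → ℝ) : Prop :=
  Continuous h ∧ ∃ (κ : Type) (_ : Finite κ) (C : κ → Set E) (A : κ → E →ᵃ[ℝ] ℝ),
    (∀ k, Convex ℝ (C k)) ∧ (∀ x, ∃ k, x ∈ C k) ∧ ∀ k, ∀ x ∈ C k, h x = A k x

/-! ### Finitely convex sets and piecewise affine functions -/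

namespace IsFinitelyConvex

variable {E : Type*} [AddCommGroup E] [Module ℝ E]

theorem empty : IsFinitelyConvex (∅ : Set E) :=
  ⟨Unit, inferInstance, fun _ => ∅, fun _ => convex_empty, by simp⟩

theorem univ : IsFinitelyConvex (Set.univ : Set E) :=
  ⟨Unit, inferInstance, fun _ => Set.univ, fun _ => convex_univ, (Set.iUnion_const _).symm⟩

theorem inter {V W : Set E} (hV : IsFinitelyConvex V) (hW : IsFinitelyConvex W) :
    IsFinitelyConvex (V ∩ W) := by
  obtain ⟨κ, _, C, hC, rfl⟩ := hV
  obtain ⟨μ, _, D, hD, rfl⟩ := hW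
  refine ⟨κ × μ, inferInstance, fun p => C p.1 ∩ D p.2, fun p => (hC _).inter (hD _), ?_⟩
  ext x
  simp

theorem biInter {α : Type*} (s : Finset α) {V : α → Set E}
    (hV : ∀ a ∈ s, IsFinitelyConvex (V a)) : IsFinitelyConvex {x | ∀ a ∈ s, x ∈ V a} := by
  classical
  induction s using Finset.induction_on with
  | empty => simpa using univ
  | insert a s _ ih =>
    have h := (hV a (Finset.mem_insert_self a s)).inter
      (ih fun b hb => hV b (Finset.mem_insert_of_mem hb))
    convert h using 1
    ext x
    simp

/-- An infinite family of points of a finitely convex set has two members spanning a segment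
inside the set. -/
theorem exists_segment_subset {V : Set E} (hV : IsFinitelyConvex V) {ι : Type*} [Infinite ι]
    {x : ι → E} (hx : ∀ i, x i ∈ V) : ∃ i j, i ≠ j ∧ segment ℝ (x i) (x j) ⊆ V := by
  obtain ⟨κ, _, C, hC, rfl⟩ := hV
  choose k hk using fun i => Set.mem_iUnion.1 (hx i)
  obtain ⟨i, j, hij, hk'⟩ := Finite.exists_ne_map_eq_of_infinite k
  exact ⟨i, j, hij, ((hC (k i)).segment_subset (hk i) (hk' ▸ hk j)).trans
    (Set.subset_iUnion C (k i))⟩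

end IsFinitelyConvex

namespace IsPiecewiseAffine

variable {E : Type*} [AddCommGroup E] [Module ℝ E] [TopologicalSpace E]

theorem of_affineMap (A : E →ᵃ[ℝ] ℝ) (hA : Continuous A) : IsPiecewiseAffine (A : E → ℝ) :=
  ⟨hA, Unit, inferInstance, fun _ => Set.univ, fun _ => A, fun _ => convex_univ,
    fun _ => ⟨(), trivial⟩, fun _ _ _ => rfl⟩

theorem const (r : ℝ) : IsPiecewiseAffine (fun _ : E => r) :=
  of_affineMap (AffineMap.const ℝ E r) continuous_const

theorem add {f g : E → ℝ} (hf : IsPiecewiseAffine f) (hg : IsPiecewiseAffine g) :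
    IsPiecewiseAffine (fun x => f x + g x) := by
  obtain ⟨hfc, κ, _, C, A, hC, hcov, hA⟩ := hf
  obtain ⟨hgc, μ, _, D, B, hD, hcov', hB⟩ := hg
  refine ⟨hfc.add hgc, κ × μ, inferInstance, fun p => C p.1 ∩ D p.2, fun p => A p.1 + B p.2,
    fun p => (hC _).inter (hD _), fun x => ?_, fun p x hx => ?_⟩
  · obtain ⟨k, hk⟩ := hcov x
    obtain ⟨l, hl⟩ := hcov' x
    exact ⟨(k, l), hk, hl⟩
  · exact congrArg₂ (· + ·) (hA _ x hx.1) (hB _ x hx.2)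

theorem neg {f : E → ℝ} (hf : IsPiecewiseAffine f) : IsPiecewiseAffine (fun x => -f x) := by
  obtain ⟨hfc, κ, _, C, A, hC, hcov, hA⟩ := hf
  refine ⟨hfc.neg, κ, inferInstance, C, fun k => -A k, hC, hcov, fun k x hx => ?_⟩
  exact congrArg Neg.neg (hA k x hx)

theorem sub {f g : E → ℝ} (hf : IsPiecewiseAffine f) (hg : IsPiecewiseAffine g) :
    IsPiecewiseAffine (fun x => f x - g x) := by
  simpa only [sub_eq_add_neg] using hf.add hg.neg

theorem isFinitelyConvex_zeros {f : E → ℝ} (hf : IsPiecewiseAffine f) :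
    IsFinitelyConvex {x | f x = 0} := by
  obtain ⟨-, κ, _, C, A, hC, hcov, hA⟩ := hf
  refine ⟨κ, inferInstance, fun k => C k ∩ A k ⁻¹' {0},
    fun k => (hC k).inter ((convex_singleton 0).affine_preimage (A k)), ?_⟩
  ext x
  simp only [Set.mem_ofPred_eq, Set.mem_iUnion, Set.mem_inter_iff, Set.mem_preimage,
    Set.mem_singleton_iff]
  constructor
  · intro h
    obtain ⟨k, hk⟩ := hcov x
    exact ⟨k, hk, by rw [← hA k x hk, h]⟩
  · rintro ⟨k, hk, h⟩
    rw [hA k x hk, h]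

theorem max {f g : E → ℝ} (hf : IsPiecewiseAffine f) (hg : IsPiecewiseAffine g) :
    IsPiecewiseAffine (fun x => max (f x) (g x)) := by
  obtain ⟨hfc, κ, _, C, A, hC, hcov, hA⟩ := hf
  obtain ⟨hgc, μ, _, D, B, hD, hcov', hB⟩ := hg
  refine ⟨hfc.max hgc, (κ × μ) ⊕ (κ × μ), inferInstance,
    -- Each common piece is cut by the half-space where one affine function dominates the other.
    Sum.elim (fun p => (C p.1 ∩ D p.2) ∩ (B p.2 - A p.1) ⁻¹' Set.Iic 0)
      (fun p => (C p.1 ∩ D p.2) ∩ (A p.1 - B p.2) ⁻¹' Set.Iic 0),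
    Sum.elim (fun p => A p.1) (fun p => B p.2), ?_, ?_, ?_⟩
  · rintro (p | p)
    · exact ((hC _).inter (hD _)).inter ((convex_Iic 0).affine_preimage (B p.2 - A p.1))
    · exact ((hC _).inter (hD _)).inter ((convex_Iic 0).affine_preimage (A p.1 - B p.2))
  · intro x
    obtain ⟨k, hk⟩ := hcov x
    obtain ⟨l, hl⟩ := hcov' x
    rcases le_total (B l x) (A k x) with h | h
    · exact ⟨Sum.inl (k, l), ⟨hk, hl⟩, sub_nonpos.2 h⟩
    · exact ⟨Sum.inr (k, l), ⟨hk, hl⟩, sub_nonpos.2 h⟩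
  · rintro (p | p) x ⟨⟨hx, hx'⟩, h⟩
    · exact (congrArg₂ Max.max (hA _ x hx) (hB _ x hx')).trans (max_eq_left (sub_nonpos.1 h))
    · exact (congrArg₂ Max.max (hA _ x hx) (hB _ x hx')).trans (max_eq_right (sub_nonpos.1 h))

end IsPiecewiseAffine

/-! ### Tropical rational functions on ℝⁿ and their varieties -/

namespace Trop

theorem ofReal_injective : Function.Injective ofReal := WithBot.coe_injective

theorem ofReal_add (r s : ℝ) : ofReal r + ofReal s = ofReal (max r s) :=
  (WithBot.coe_max r s).symm

end Trop

/-- The value of a tropical polynomial function on `ℝⁿ` is identically zero or piecewise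
affine. -/
theorem MvPolynomial.eval_ofReal_piecewiseAffine {n : ℕ} (p : MvPolynomial (Fin n) Trop) :
    (∀ x : Fin n → ℝ, MvPolynomial.eval (fun i => Trop.ofReal (x i)) p = 0) ∨
      ∃ h : (Fin n → ℝ) → ℝ, IsPiecewiseAffine h ∧
        ∀ x, MvPolynomial.eval (fun i => Trop.ofReal (x i)) p = Trop.ofReal (h x) := by
  induction p using MvPolynomial.induction_on with
  | C a =>
    by_cases ha : a = 0
    · exact Or.inl fun x => by rw [MvPolynomial.eval_C, ha]
    · obtain ⟨r, rfl⟩ := Trop.exists_ofReal_of_ne_zero ha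
      exact Or.inr ⟨_, .const r, fun x => MvPolynomial.eval_C _⟩
  | add p q hp hq =>
    simp only [map_add]
    rcases hp with hp | ⟨f, hf, hp⟩
    · simpa only [hp, zero_add] using hq
    · rcases hq with hq | ⟨g, hg, hq⟩
      · exact Or.inr ⟨f, hf, fun x => by rw [hp, hq, add_zero]⟩
      · exact Or.inr ⟨_, hf.max hg, fun x => by rw [hp, hq, Trop.ofReal_add]⟩
  | mul_X p i hp =>
    simp only [map_mul, MvPolynomial.eval_X]
    rcases hp with hp | ⟨f, hf, hp⟩
    · exact Or.inl fun x => by rw [hp, zero_mul]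
    · have hi : IsPiecewiseAffine (fun x : Fin n → ℝ => x i) :=
        .of_affineMap (LinearMap.proj i : (Fin n → ℝ) →ₗ[ℝ] ℝ).toAffineMap (continuous_apply i)
      exact Or.inr ⟨_, hf.add hi, fun x => by rw [hp, Trop.ofReal_mul]⟩

theorem TropPolyFun.eval_piecewiseAffine {n : ℕ} {f : TropPolyFun n} (hf : f ≠ 0) :
    ∃ h : (Fin n → ℝ) → ℝ, IsPiecewiseAffine h ∧
      ∀ x, TropPolyFun.eval (fun i => Trop.ofReal (x i)) f = Trop.ofReal (h x) := by
  have h0 := TropPolyFun.eval_ofReal_ne_zero (fun _ => 0) hf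
  obtain ⟨p, rfl⟩ := (tropFunCon n).mk'_surjective f
  rcases MvPolynomial.eval_ofReal_piecewiseAffine p with h | h
  · exact absurd (h fun _ => 0) h0
  · exact h

namespace TropRat

theorem eval_algebraMap_polyFun {n : ℕ} (x : Fin n → ℝ) (f : TropPolyFun n) :
    eval x (algebraMap (TropPolyFun n) (TropRat n) f) =
      TropPolyFun.eval (fun i => Trop.ofReal (x i)) f :=
  IsLocalization.lift_eq _ _

theorem eval_algebraMap {n : ℕ} (x : Fin n → ℝ) (a : Trop) :
    eval x (algebraMap Trop (TropRat n) a) = a := by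
  rw [IsScalarTower.algebraMap_apply Trop (TropPolyFun n) (TropRat n), eval_algebraMap_polyFun]
  exact MvPolynomial.eval_C a

theorem eval_piecewiseAffine {n : ℕ} {f : TropRat n} (hf : f ≠ 0) :
    ∃ h : (Fin n → ℝ) → ℝ, IsPiecewiseAffine h ∧ ∀ x, eval x f = Trop.ofReal (h x) := by
  obtain ⟨p, q, rfl⟩ := IsLocalization.exists_mk'_eq (nonZeroDivisors (TropPolyFun n)) f
  have hp : p ≠ 0 := by
    rintro rfl
    exact hf (IsLocalization.mk'_zero q)
  obtain ⟨g, hg, hpg⟩ := TropPolyFun.eval_piecewiseAffine hp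
  obtain ⟨k, hk, hqk⟩ := TropPolyFun.eval_piecewiseAffine (nonZeroDivisors.ne_zero q.2)
  refine ⟨_, hg.sub hk, fun x => ?_⟩
  have h := congrArg (eval x) (IsLocalization.mk'_spec (TropRat n) p q)
  rw [map_mul, eval_algebraMap_polyFun, eval_algebraMap_polyFun, hpg, hqk] at h
  refine mul_right_cancel₀ (Trop.ofReal_ne_zero (k x)) (h.trans ?_)
  rw [Trop.ofReal_mul, sub_add_cancel]

/-- For nonzero f and g this is the zero set of a difference of piecewise affine functions. A
nonzero function never takes the value 0 of `Trop`, which settles the other cases. -/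
theorem isFinitelyConvex_eval_eq {n : ℕ} (f g : TropRat n) :
    IsFinitelyConvex {x | eval x f = eval x g} := by
  by_cases hf : f = 0
  · by_cases hg : g = 0
    · simpa [hf, hg] using IsFinitelyConvex.univ
    · obtain ⟨h, -, hh⟩ := eval_piecewiseAffine hg
      simpa [hf, hh, (Trop.ofReal_ne_zero _).symm] using IsFinitelyConvex.empty
  · obtain ⟨h, hpa, hh⟩ := eval_piecewiseAffine hf
    by_cases hg : g = 0
    · simpa [hg, hh, Trop.ofReal_ne_zero] using IsFinitelyConvex.empty
    · obtain ⟨k, kpa, hk⟩ := eval_piecewiseAffine hg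
      simpa only [hh, hk, Trop.ofReal_injective.eq_iff, sub_eq_zero] using
        (hpa.sub kpa).isFinitelyConvex_zeros

/-- The variety of a finitely generated congruence is a finite union of convex sets. -/
theorem isFinitelyConvex_variety {n : ℕ} {E : RingCon (TropRat n)}
    (hE : E.IsFinitelyGenerated) : IsFinitelyConvex (variety E) := by
  obtain ⟨s, rfl⟩ := hE
  convert IsFinitelyConvex.biInter s (V := fun p => {x | eval x p.1 = eval x p.2})
    fun p _ => isFinitelyConvex_eval_eq p.1 p.2 using 1
  ext x
  refine ⟨fun hx p hp => hx _ _ (RingConGen.Rel.of _ _ hp), fun hx f g hfg => ?_⟩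
  -- Equality of values at x is itself a congruence, so it need only be checked on generators.
  have hle : ringConGen (fun a b => (a, b) ∈ s) ≤ RingCon.ker (eval x) :=
    RingCon.ringConGen_le.2 fun a b hab => hx (a, b) hab
  exact hle hfg

/-- A homomorphism defined on the target of a surjection `φ` by evaluating preimages at a
point of the variety of the kernel of `φ`. -/
theorem exists_evalOn {T : Type*} [Semiring T] {n : ℕ} (φ : TropRat n →+* T)
    (hφ : Function.Surjective φ) {x : Fin n → ℝ} (hx : x ∈ variety (RingCon.ker φ)) :
    ∃ ψ : T →+* Trop, ∀ f, ψ (φ f) = eval x f := by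
  have key : ∀ f, eval x (Function.surjInv hφ (φ f)) = eval x f :=
    fun f => hx _ _ (Function.surjInv_eq hφ (φ f))
  refine ⟨{ toFun := fun t => eval x (Function.surjInv hφ t)
            map_one' := ?_
            map_mul' := fun a b => ?_
            map_zero' := ?_
            map_add' := fun a b => ?_ }, key⟩
  · rw [← map_one φ, key, map_one]
  · obtain ⟨f, rfl⟩ := hφ a
    obtain ⟨g, rfl⟩ := hφ b
    rw [← map_mul, key, key, key, map_mul]
  · rw [← map_zero φ, key, map_zero]
  · obtain ⟨f, rfl⟩ := hφ a
    obtain ⟨g, rfl⟩ := hφ b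
    rw [← map_add, key, key, key, map_add]

end TropRat

/-! ### Indicator elements of the pseudodirect product -/

namespace pseudodirectProduct

variable {ι : Type*} [DecidableEq ι] (S : ι → Type*) [∀ i, Semifield (S i)]
  [∀ i, Algebra Trop (S i)]

/-- The family with entry `a` at `i` and `b` elsewhere. -/
noncomputable def single (i : ι) (a b : ℝ) : pseudodirectProduct S :=
  ⟨fun j => algebraMap Trop (S j) (Trop.ofReal (if j = i then a else b)), Or.inl fun j =>
    ((isUnit_iff_ne_zero.2 (Trop.ofReal_ne_zero _)).map (algebraMap Trop (S j))).ne_zero⟩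

/-- Together with `single_add_single`, this forces real values h, r of the two elements to satisfy h
+ r = 1 and max h r = 1, hence h = 0 or h = 1. -/
theorem single_mul_single (i : ι) :
    single S i 1 0 * single S i 0 1 = algebraMap Trop _ (Trop.ofReal 1) := by
  ext j
  change algebraMap Trop (S j) _ * algebraMap Trop (S j) _ = algebraMap Trop (S j) _
  rw [← map_mul, Trop.ofReal_mul]
  split_ifs <;> simp

theorem single_add_single (i : ι) :
    single S i 1 0 + single S i 0 1 = algebraMap Trop _ (Trop.ofReal 1) := by
  ext j
  change algebraMap Trop (S j) _ + algebraMap Trop (S j) _ = algebraMap Trop (S j) _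
  rw [← map_add, Trop.ofReal_add]
  split_ifs <;> simp

/-- No index equals both i and j, so the entries of the product are at most 1. In terms of real
values this reads h_i + h_j ≤ 1. -/
theorem single_mul_single_add {i j : ι} (hij : i ≠ j) :
    single S i 1 0 * single S j 1 0 + algebraMap Trop _ (Trop.ofReal 1) =
      algebraMap Trop _ (Trop.ofReal 1) := by
  ext k
  change algebraMap Trop (S k) _ * algebraMap Trop (S k) _ + algebraMap Trop (S k) _ =
    algebraMap Trop (S k) _
  rw [← map_mul, ← map_add, Trop.ofReal_mul, Trop.ofReal_add]
  congr 2
  by_cases hi : k = i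
  · have hj : k ≠ j := hi ▸ hij
    simp [hi, hij]
  · by_cases hj : k = j <;> simp [hi, hj, hij.symm]

theorem single_ne_one {i : ι} (hi : IsSemifieldOverTrop (S i)) : single S i 1 0 ≠ 1 := by
  intro h
  have h1 : algebraMap Trop (S i) (Trop.ofReal (if i = i then 1 else 0)) = 1 :=
    congrFun (congrArg Subtype.val h) i
  rw [if_pos rfl, ← map_one (algebraMap Trop (S i))] at h1
  exact one_ne_zero (Trop.ofReal_injective (hi h1))

end pseudodirectProduct

/-! ### Contradiction on a segment of the variety -/

theorem corollary3p29 {T : Type*} [Semifield T] [Algebra Trop T]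
    (hT : IsSemifieldOverTrop T) (hTfg : IsFinitelyGeneratedSemifieldOverTrop T)
    {m : ℕ} (φ : TropRat m →ₐ[Trop] T) (hφ : Function.Surjective φ)
    (hker : RingCon.ker (φ : TropRat m →+* T) =
      TropRat.vanishingCon (TropRat.variety (RingCon.ker (φ : TropRat m →+* T))))
    (hkerfg : (RingCon.ker (φ : TropRat m →+* T)).IsFinitelyGenerated)
    {ι : Type*} [Infinite ι] (S : ι → Type*) [∀ i, Semifield (S i)]
    [∀ i, Algebra Trop (S i)] (hS : ∀ i, IsSemifieldOverTrop (S i)) :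
    IsEmpty (T ≃ₐ[Trop] pseudodirectProduct S) := by
  classical
  refine ⟨fun Φ => ?_⟩
  set V := TropRat.variety (RingCon.ker (φ : TropRat m →+* T)) with hV
  have hconv : IsFinitelyConvex V := TropRat.isFinitelyConvex_variety hkerfg
  have hsep : ∀ f g : TropRat m, (∀ x ∈ V, TropRat.eval x f = TropRat.eval x g) →
      φ f = φ g := by
    intro f g h
    have h' : RingCon.ker (φ : TropRat m →+* T) f g := by
      rw [hker]
      exact h
    exact h'
  -- Each point of V evaluates elements of the product and fixes constants, so identities there
  -- become identities between values.
  have hev : ∀ x ∈ V, ∃ ψ : pseudodirectProduct S →+* Trop,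
      (∀ f, ψ (Φ (φ f)) = TropRat.eval x f) ∧ ∀ a, ψ (algebraMap Trop _ a) = a := by
    intro x hx
    obtain ⟨ψ, hψ⟩ := TropRat.exists_evalOn (φ : TropRat m →+* T) hφ hx
    have h1 : ∀ f, (ψ.comp (Φ.symm : pseudodirectProduct S →+* T)) (Φ (φ f)) =
        TropRat.eval x f := by
      intro f
      have h2 : Φ.symm (Φ (φ f)) = φ f := Φ.symm_apply_apply _
      exact (congrArg ψ h2).trans (hψ f)
    refine ⟨_, h1, fun a => ?_⟩
    rw [← AlgEquiv.commutes Φ, ← AlgHom.commutes φ, h1, TropRat.eval_algebraMap]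
  choose ψ hψ hψa using hev
  have hlift : ∀ i, ∃ f : TropRat m, Φ (φ f) = pseudodirectProduct.single S i 1 0 := fun i => by
    obtain ⟨f, hf⟩ := hφ (Φ.symm (pseudodirectProduct.single S i 1 0))
    exact ⟨f, by rw [hf, AlgEquiv.apply_symm_apply]⟩
  choose f hf using hlift
  have hf0 : ∀ i, f i ≠ 0 := by
    intro i h
    have h1 := hf i
    rw [h, map_zero, map_zero] at h1
    have h2 : (0 : S i) = algebraMap Trop (S i) _ := congrFun (congrArg Subtype.val h1) i
    rw [← map_zero (algebraMap Trop (S i))] at h2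
    exact Trop.ofReal_ne_zero _ (hS i h2).symm
  choose h hpa hh using fun i => TropRat.eval_piecewiseAffine (hf0 i)
  have hsingle : ∀ i, ∀ x (hx : x ∈ V),
      ψ x hx (pseudodirectProduct.single S i 1 0) = Trop.ofReal (h i x) := fun i x hx => by
    rw [← hf, hψ x hx, hh]
  have h01 : ∀ i, ∀ x ∈ V, h i x = 0 ∨ h i x = 1 := by
    intro i x hx
    have hmul := congrArg (ψ x hx) (pseudodirectProduct.single_mul_single S i)
    have hadd := congrArg (ψ x hx) (pseudodirectProduct.single_add_single S i)
    rw [map_mul, hψa x hx, hsingle i x hx] at hmul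
    rw [map_add, hψa x hx, hsingle i x hx] at hadd
    obtain ⟨r, hr⟩ : ∃ r, ψ x hx (pseudodirectProduct.single S i 0 1) = Trop.ofReal r :=
      Trop.exists_ofReal_of_ne_zero fun h0 => by
        rw [h0, mul_zero] at hmul
        exact Trop.ofReal_ne_zero _ hmul.symm
    rw [hr, Trop.ofReal_mul] at hmul
    rw [hr, Trop.ofReal_add] at hadd
    have h1 := Trop.ofReal_injective hmul
    have h2 := Trop.ofReal_injective hadd
    rcases max_choice (h i x) r with h3 | h3
    · exact Or.inr (h3.symm.trans h2)
    · left
      linarith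
  have hpoint : ∀ i, ∃ x ∈ V, h i x = 1 := by
    intro i
    by_contra! hne
    -- A function with real value 0 on all of V agrees there with the tropical one; this is where
    -- the kernel being E(V) enters.
    have h1 : φ (f i) = φ 1 := hsep _ _ fun x hx => by
      rw [hh, (h01 i x hx).resolve_right (hne x hx), map_one]
      rfl
    refine pseudodirectProduct.single_ne_one S (hS i) ?_
    rw [← hf, h1, map_one, map_one]
  choose x hxV hx using hpoint
  obtain ⟨i, j, hij, hseg⟩ := hconv.exists_segment_subset hxV
  have hij0 : h i (x j) = 0 := by
    have h1 := congrArg (ψ (x j) (hxV j)) (pseudodirectProduct.single_mul_single_add S hij)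
    rw [map_add, map_mul, hψa _ (hxV j), hsingle i _ (hxV j), hsingle j _ (hxV j), hx j,
      Trop.ofReal_mul, Trop.ofReal_add] at h1
    have h2 := max_eq_right_iff.1 (Trop.ofReal_injective h1)
    refine (h01 i _ (hxV j)).resolve_right fun h3 => ?_
    linarith
  -- Any value strictly between 0 and 1 would do in place of 1/2.
  obtain ⟨y, hy, hy'⟩ := (convex_segment (x i) (x j)).isPreconnected.intermediate_value
    (right_mem_segment ℝ (x i) (x j)) (left_mem_segment ℝ (x i) (x j))
    (hpa i).1.continuousOn (show (1 / 2 : ℝ) ∈ Set.Icc (h i (x j)) (h i (x i)) by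
      rw [hij0, hx i]; norm_num)
  rcases h01 i y (hseg hy) with h0 | h1 <;> linarith
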